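/- Let $N$ be an odd perfect number, that is, an odd positive integer with $\sigma(N) = 2N$, where $\sigma(N)$ denotes the sum of all positive divisors of $N$. Write $N = p^{\alpha} q_1^{2\beta_1} \cdots q_{r-1}^{2\beta_{r-1}}$, where $r \ge 1$, $p, q_1, \ldots, q_{r-1}$ are distinct odd primes, and $\alpha, \beta_1, \ldots, \beta_{r-1}$ are positive integers with $p \equiv \alpha \equiv 1 \pmod 4$ (by a theorem of Euler, every odd perfect number has this form). If an integer $t$ divides $2\beta_i + 1$ for every $i = 1, \ldots, r-1$, then $t^5$ divides $N$. -/

import Mathlib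

/-! ### Primes with a prescribed multiplicative order -/

/-! It suffices to show `5 * a ≤ N.factorization l` for each prime power `l ^ a` exactly dividing
`t`. Two mechanisms drive this. By Zsigmondy's theorem (`exists_prime_orderOf_eq`), each divisor `d`
of `e + 1`, for a non-special exponent `e`, that is a multiple of `l` forces a prime divisor of `N`
congruent to 1 mod `l`. Conversely, each such prime, if non-special, contributes a factor `l ^ a` to
`σ(N) = 2N` (`mul_card_le`).

If `l ∤ N`, only `p` can be 1 mod `l`. Then every non-special exponent is `l - 1`, every `σ(q ^ (l -
1))` is a power of `p`, and lifting the exponent makes the exponent of `p` impossibly large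
(`dvd_of_dvd_exp`).

If `l ∣ N` and `l ≠ p`, then `l ^ a` divides `N.factorization l + 1`. This suffices unless `l ^ a`
is 3, 5 or 9 and the exponent is exactly `l ^ a - 1`. Those cases die by exhibiting too many primes
1 mod `l`.

If `l = p` and `p` has exponent below `5a`, at most four non-special primes are 1 mod `p`, which
makes their `σ`-factors so rigid that a size comparison gives a contradiction
(`special_mul_le_of_two_le`, for `a ≥ 2`). -/

theorem natCast_pow_eq_one_iff_dvd_sub_one {s u : ℕ} (hs : 0 < s) (n : ℕ) :
    (s : ZMod u) ^ n = 1 ↔ u ∣ s ^ n - 1 := by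
  have h : 1 ≤ s ^ n := Nat.one_le_pow _ _ hs
  rw [← ZMod.natCast_eq_zero_iff, Nat.cast_sub h, sub_eq_zero]
  simp

/-- Fermat's little theorem. A nonzero `orderOf` encodes `u ∤ s`, since the zero class has order 0
by convention. -/
theorem orderOf_natCast_dvd_sub_one {s u : ℕ} (hu : u.Prime) (h0 : orderOf (s : ZMod u) ≠ 0) :
    orderOf (s : ZMod u) ∣ u - 1 := by
  have := Fact.mk hu
  apply orderOf_dvd_of_pow_eq_one
  apply ZMod.pow_card_sub_one_eq_one
  intro h
  rw [h, orderOf_zero] at h0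
  exact h0 rfl

theorem sub_one_mul_cyclotomic_dvd {s d n : ℕ} (hs : 0 < s) (hd : d ∈ n.properDivisors) :
    (s ^ d - 1) * ((Polynomial.cyclotomic n ℤ).eval (s : ℤ)).natAbs ∣ s ^ n - 1 := by
  have h := Polynomial.eval_dvd (x := (s : ℤ))
    (Polynomial.X_pow_sub_one_mul_cyclotomic_dvd_X_pow_sub_one_of_dvd ℤ hd)
  have h2 := Int.natAbs_dvd_natAbs.mpr h
  simp only [Polynomial.eval_mul, Polynomial.eval_sub, Polynomial.eval_pow, Polynomial.eval_X,
    Polynomial.eval_one, Int.natAbs_mul] at h2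
  have e : ∀ k : ℕ, ((s : ℤ) ^ k - 1).natAbs = s ^ k - 1 := fun k => by
    have h : 1 ≤ s ^ k := Nat.one_le_pow _ _ hs
    have : ((s : ℤ) ^ k - 1) = ((s ^ k - 1 : ℕ) : ℤ) := by push_cast [h]; ring
    rw [this, Int.natAbs_natCast]
  rwa [e, e] at h2

theorem prime_dvd_cyclotomic_dvd_pow_sub_one {s u n : ℕ} (hs : 0 < s) (hn : 1 < n)
    (h : u ∣ ((Polynomial.cyclotomic n ℤ).eval (s : ℤ)).natAbs) : u ∣ s ^ n - 1 :=
  h.trans ((Dvd.intro_left _ rfl).trans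
    (sub_one_mul_cyclotomic_dvd (d := 1) hs (Nat.mem_properDivisors.mpr ⟨one_dvd _, hn⟩)))

theorem orderOf_eq_of_dvd_cyclotomic {s u n : ℕ} (hu : u.Prime) (hun : ¬ u ∣ n)
    (h : u ∣ ((Polynomial.cyclotomic n ℤ).eval (s : ℤ)).natAbs) :
    orderOf (s : ZMod u) = n := by
  have := Fact.mk hu
  have : NeZero (n : ZMod u) := ⟨by rwa [Ne, ZMod.natCast_eq_zero_iff]⟩
  refine (Polynomial.isRoot_cyclotomic_iff.mp ?_).eq_orderOf.symm
  have h1 : (u : ℤ) ∣ (Polynomial.cyclotomic n ℤ).eval (s : ℤ) := Int.natCast_dvd.mpr h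
  rw [← ZMod.intCast_zmod_eq_zero_iff_dvd] at h1
  rw [Polynomial.IsRoot, ← Polynomial.map_cyclotomic_int, ← h1]
  have := Polynomial.eval_intCast_map (Int.castRingHom (ZMod u)) (Polynomial.cyclotomic n ℤ) s
  simpa using this

/-- Lifting the exponent gives `s ^ (m * w) - 1` exactly `padicValNat u w` more factors `u` than `s
^ m - 1`, and the cyclotomic value divides the quotient. -/
theorem padicValNat_cyclotomic_le {s u m w : ℕ} (hs : 3 ≤ s) (hu : u.Prime) (hu2 : Odd u)
    (hm : 0 < m) (hw : 1 < w) (h : u ∣ s ^ m - 1) :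
    padicValNat u ((Polynomial.cyclotomic (m * w) ℤ).eval (s : ℤ)).natAbs ≤ padicValNat u w := by
  have := Fact.mk hu
  have hmem : m ∈ (m * w).properDivisors :=
    Nat.mem_properDivisors.mpr ⟨Dvd.intro _ rfl, by nlinarith⟩
  have hd := sub_one_mul_cyclotomic_dvd (s := s) (by omega) hmem
  have h1 : 1 < s ^ m := Nat.one_lt_pow hm.ne' (by omega)
  have h2 : 1 < s ^ (m * w) := Nat.one_lt_pow (by positivity) (by omega)
  have hus : ¬ u ∣ s ^ m := by
    intro hus
    have := (Nat.dvd_sub_iff_right h1.le hus).mp h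
    exact hu.one_lt.ne' (Nat.dvd_one.mp this)
  have hC : ((Polynomial.cyclotomic (m * w) ℤ).eval (s : ℤ)).natAbs ≠ 0 := by
    intro h0
    rw [h0, mul_zero, zero_dvd_iff] at hd
    omega
  have hlte := padicValNat.pow_sub_pow hu2 h1 (x := s ^ m) (y := 1) (by simpa using h) hus
    (n := w) (by omega)
  rw [one_pow, ← pow_mul] at hlte
  have hle := (padicValNat_dvd_iff_le (p := u) (a := s ^ (m * w) - 1)
    (n := padicValNat u ((s ^ m - 1) * ((Polynomial.cyclotomic (m * w) ℤ).eval (s : ℤ)).natAbs))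
    (by omega)).mp (pow_padicValNat_dvd.trans hd)
  rw [padicValNat.mul (by omega) hC] at hle
  omega

/-- If `w` missed the order of `s` mod `u`, that order would divide `n / w`, and the valuation bound
would make the cyclotomic value prime to `u`. So `w` divides the order, hence `u - 1`. -/
theorem lt_of_prime_dvd_cyclotomic {s n u w : ℕ} (hs : 3 ≤ s) (hn : 1 < n)
    (hu : u.Prime) (hu2 : Odd u) (hw : w.Prime) (hwn : w ∣ n) (hne : w ≠ u)
    (h : u ∣ ((Polynomial.cyclotomic n ℤ).eval (s : ℤ)).natAbs) : w < u := by
  have := Fact.mk hu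
  have hsn := (natCast_pow_eq_one_iff_dvd_sub_one (by omega) n).mpr
    (prime_dvd_cyclotomic_dvd_pow_sub_one (by omega) hn h)
  have hen := orderOf_dvd_of_pow_eq_one hsn
  have he0 : orderOf (s : ZMod u) ≠ 0 := by
    intro h0
    rw [h0, zero_dvd_iff] at hen
    omega
  have heu := orderOf_natCast_dvd_sub_one hu he0
  suffices hwe : w ∣ orderOf (s : ZMod u) by
    have := Nat.le_of_dvd (Nat.sub_pos_of_lt hu.one_lt) (hwe.trans heu)
    have := hu.one_lt
    omega
  by_contra hwe
  obtain ⟨f, hf⟩ := hen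
  have hwf : w ∣ f := (hw.dvd_mul.mp (hf ▸ hwn)).resolve_left hwe
  obtain ⟨g, rfl⟩ := hwf
  have hm : n = (orderOf (s : ZMod u) * g) * w := by rw [hf]; ring
  have hm0 : 0 < orderOf (s : ZMod u) * g := by
    rcases Nat.eq_zero_or_pos (orderOf (s : ZMod u) * g) with h0 | h0
    · rw [h0] at hm; omega
    · exact h0
  have hd : u ∣ s ^ (orderOf (s : ZMod u) * g) - 1 := by
    rw [← natCast_pow_eq_one_iff_dvd_sub_one (by omega), pow_mul, pow_orderOf_eq_one, one_pow]
  have hle := padicValNat_cyclotomic_le hs hu hu2 hm0 hw.one_lt hd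
  rw [← hm] at hle
  have hz : padicValNat u w = 0 :=
    padicValNat.eq_zero_of_not_dvd fun hd => hne ((Nat.prime_dvd_prime_iff_eq hu hw).mp hd).symm
  have hC : ((Polynomial.cyclotomic n ℤ).eval (s : ℤ)).natAbs ≠ 0 := by
    have := Polynomial.sub_one_pow_totient_lt_natAbs_cyclotomic_eval (q := s) hn (by omega)
    omega
  have := one_le_padicValNat_of_dvd hC h
  omega

/-- The case of odd exponents of Zsigmondy's theorem. -/
theorem exists_prime_orderOf_eq {s n : ℕ} (hs : 3 ≤ s) (hodd : Odd n) (hn : 1 < n) :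
    ∃ u : ℕ, u.Prime ∧ orderOf (s : ZMod u) = n := by
  -- Otherwise every prime factor of `C` divides `n`. There is only one such prime `u`, and it
  -- occurs once, so `C ≤ u`; but `C > (s - 1) ^ φ(n) ≥ 2 ^ (u - 1) ≥ u`.
  by_contra! hno
  set C := ((Polynomial.cyclotomic n ℤ).eval (s : ℤ)).natAbs with hCdef
  have hCbig : (s - 1) ^ n.totient < C :=
    Polynomial.sub_one_pow_totient_lt_natAbs_cyclotomic_eval hn (by omega)
  have hpn : ∀ u : ℕ, u.Prime → u ∣ C → u ∣ n := fun u hu h => by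
    by_contra hun
    exact hno u hu (orderOf_eq_of_dvd_cyclotomic hu hun h)
  have h2t : 1 ≤ (s - 1) ^ n.totient := Nat.one_le_pow _ _ (by omega)
  have hu : C.minFac.Prime := Nat.minFac_prime (by omega)
  set u := C.minFac with hudef
  have huC : u ∣ C := Nat.minFac_dvd C
  have hun : u ∣ n := hpn u hu huC
  have hu2 : Odd u := hodd.of_dvd_nat hun
  have := Fact.mk hu
  obtain ⟨m, hm⟩ := hun
  have hm0 : 0 < m := by
    rcases Nat.eq_zero_or_pos m with h0 | h0
    · rw [h0] at hm; omega
    · exact h0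
  have hsm : u ∣ s ^ m - 1 := by
    rw [← natCast_pow_eq_one_iff_dvd_sub_one (by omega)]
    have h := (natCast_pow_eq_one_iff_dvd_sub_one (by omega) n).mpr
      (prime_dvd_cyclotomic_dvd_pow_sub_one (s := s) (by omega) hn huC)
    rwa [hm, mul_comm, pow_mul, ZMod.pow_card] at h
  have hle := padicValNat_cyclotomic_le hs hu hu2 hm0 hu.one_lt hsm
  rw [mul_comm, ← hm, padicValNat_self, ← hCdef] at hle
  -- Two distinct prime factors would each be smaller than the other.
  have huniq : ∀ w : ℕ, w.Prime → w ∣ C → w = u := fun w hw hwC => by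
    by_contra hne
    have h1 := lt_of_prime_dvd_cyclotomic hs hn hu hu2 hw (hpn w hw hwC) hne huC
    have h2 := lt_of_prime_dvd_cyclotomic hs hn hw (hodd.of_dvd_nat (hpn w hw hwC)) hu
      (hpn u hu huC) (Ne.symm hne) hwC
    omega
  have hCpow := Nat.eq_prime_pow_of_unique_prime_dvd (n := C) (p := u) (by omega)
    (fun {d} hd hdC => huniq d hd hdC)
  have hCu : C ≤ u := by
    obtain ⟨e, he⟩ : ∃ e, C = u ^ e := ⟨_, hCpow⟩
    have he1 : e ≤ 1 := by
      rwa [he, padicValNat.prime_pow] at hle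
    rw [he]
    calc u ^ e ≤ u ^ 1 := Nat.pow_le_pow_right hu.pos he1
      _ = u := pow_one u
  have htot : u - 1 ≤ n.totient := by
    rw [← Nat.totient_prime hu]
    exact Nat.le_of_dvd (Nat.totient_pos.mpr (by omega)) (Nat.totient_dvd_of_dvd ⟨m, hm⟩)
  have h3 : 2 ^ (u - 1) ≤ (s - 1) ^ n.totient :=
    (Nat.pow_le_pow_right (by norm_num) htot).trans (Nat.pow_le_pow_left (by omega) _)
  have h4 : u - 1 < 2 ^ (u - 1) := Nat.lt_two_pow_self
  omega

/-! ### Geometric sums -/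

/-- The sum `1 + s + ⋯ + s ^ (n - 1)`, which is `σ (s ^ (n - 1))` for a prime `s`. -/
def geomSum (s n : ℕ) : ℕ := ∑ k ∈ Finset.range n, s ^ k

theorem geomSum_succ (s n : ℕ) : geomSum s (n + 1) = geomSum s n + s ^ n :=
  Finset.sum_range_succ _ _

theorem geomSum_mul_sub_one {s : ℕ} (hs : 0 < s) (n : ℕ) :
    geomSum s n * (s - 1) = s ^ n - 1 := by
  have h := geom_sum_mul (s : ℤ) n
  have h1 : 1 ≤ s ^ n := Nat.one_le_pow _ _ hs
  zify [hs, h1]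
  rw [← h, geomSum]
  push_cast
  rfl

theorem geomSum_mul (s m n : ℕ) : geomSum s (m * n) = geomSum s m * geomSum (s ^ m) n := by
  induction n with
  | zero => simp [geomSum]
  | succ n ih =>
    rw [geomSum_succ, mul_add (geomSum s m), ← ih, mul_add, mul_one]
    simp only [geomSum, Finset.sum_range_add, Finset.sum_mul]
    congr 1
    exact Finset.sum_congr rfl fun i _ => by rw [pow_add, ← pow_mul, mul_comm]

theorem geomSum_dvd_geomSum (s : ℕ) {m n : ℕ} (h : m ∣ n) : geomSum s m ∣ geomSum s n := by
  obtain ⟨k, rfl⟩ := h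
  exact ⟨_, geomSum_mul s m k⟩

theorem pow_le_geomSum (s n : ℕ) : s ^ n ≤ geomSum s (n + 1) := by
  rw [geomSum_succ]; omega

theorem geomSum_pos {n : ℕ} (s : ℕ) (hn : 0 < n) : 0 < geomSum s n := by
  obtain ⟨k, rfl⟩ := Nat.exists_eq_succ_of_ne_zero hn.ne'
  rw [Nat.succ_eq_add_one, geomSum, Finset.sum_range_succ', pow_zero]
  omega

theorem geomSum_coprime (s n : ℕ) : Nat.Coprime s (geomSum s (n + 1)) := by
  have : geomSum s (n + 1) = s * geomSum s n + 1 := by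
    rw [geomSum, Finset.sum_range_succ', geomSum, Finset.mul_sum, pow_zero]
    congr 1
    exact Finset.sum_congr rfl fun i _ => by ring
  rw [this]
  simp

theorem dvd_geomSum_of_orderOf {s u n : ℕ} (hs : 0 < s) (hu : u.Prime)
    (h1 : orderOf (s : ZMod u) ≠ 1) (h : orderOf (s : ZMod u) ∣ n) : u ∣ geomSum s n := by
  have hd : u ∣ s ^ n - 1 := by
    rw [← natCast_pow_eq_one_iff_dvd_sub_one hs]
    exact orderOf_dvd_iff_pow_eq_one.mp h
  rw [← geomSum_mul_sub_one hs] at hd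
  refine (hu.dvd_mul.mp hd).resolve_right fun h2 => h1 ?_
  rw [orderOf_eq_one_iff]
  have := (natCast_pow_eq_one_iff_dvd_sub_one (u := u) hs 1).mpr (by simpa using h2)
  simpa using this

theorem geomSum_modEq_of_modEq_one {s u : ℕ} (n : ℕ) (h : s ≡ 1 [MOD u]) :
    geomSum s n ≡ n [MOD u] := by
  induction n with
  | zero => simp [geomSum]; rfl
  | succ n ih =>
    rw [geomSum_succ]
    exact ih.add (by simpa using h.pow n)

/-- The sum of length `l ^ a` factors into `a` sums of length `l`, each congruent to `l`, hence to
0, mod `l`. -/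
theorem pow_dvd_geomSum {s l a n : ℕ} (h : s ≡ 1 [MOD l]) (hn : l ^ a ∣ n) :
    l ^ a ∣ geomSum s n := by
  refine dvd_trans ?_ (geomSum_dvd_geomSum s hn)
  clear hn
  induction a with
  | zero => simp
  | succ a ih =>
    rw [pow_succ, geomSum_mul]
    refine mul_dvd_mul ih ?_
    have : geomSum (s ^ l ^ a) l ≡ l [MOD l] :=
      geomSum_modEq_of_modEq_one l (by simpa using h.pow (l ^ a))
    exact (Nat.modEq_zero_iff_dvd.mp (this.trans (by simp [Nat.ModEq])))

theorem natCast_pow_eq_one_of_dvd_geomSum {s u n : ℕ} (hs : 0 < s) (h : u ∣ geomSum s n) :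
    (s : ZMod u) ^ n = 1 := by
  rw [natCast_pow_eq_one_iff_dvd_sub_one hs, ← geomSum_mul_sub_one hs]
  exact h.mul_right _

/-- Primes dividing `1 + s + ⋯ + s ^ (l ^ a - 1)` are `l` itself or congruent to `1` modulo `l`. -/
theorem eq_or_modEq_one_of_dvd_geomSum {s l a u : ℕ} (hs : 0 < s) (hl : l.Prime) (hu : u.Prime)
    (h : u ∣ geomSum s (l ^ a)) : u = l ∨ u ≡ 1 [MOD l] := by
  have h1 := orderOf_dvd_of_pow_eq_one (natCast_pow_eq_one_of_dvd_geomSum hs h)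
  obtain ⟨j, -, hj⟩ := (Nat.dvd_prime_pow hl).mp h1
  rcases Nat.eq_zero_or_pos j with rfl | hj0
  · left
    rw [pow_zero, orderOf_eq_one_iff] at hj
    have hm : s ≡ 1 [MOD u] := by
      rw [← ZMod.natCast_eq_natCast_iff]; simpa using hj
    have h2 := (geomSum_modEq_of_modEq_one (l ^ a) hm).symm.trans
      (Nat.modEq_zero_iff_dvd.mpr h)
    exact (Nat.prime_dvd_prime_iff_eq hu hl).mp
      (hu.dvd_of_dvd_pow (Nat.modEq_zero_iff_dvd.mp h2))
  · right
    have h2 := orderOf_natCast_dvd_sub_one hu (s := s)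
      (by rw [hj]; exact (pow_pos hl.pos j).ne')
    rw [hj] at h2
    exact ((Nat.modEq_iff_dvd' hu.one_le).mpr ((dvd_pow_self l hj0.ne').trans h2)).symm

/-! ### Odd perfect numbers whose non-special exponents are all `-1` modulo `k` -/

/-- `N` is an odd perfect number with special prime `p`, and `k` divides `e + 1` for the exponent
`e` of every other prime divisor of `N`. -/
structure IsEulerPerfect (N p k : ℕ) : Prop where
  odd : Odd N
  sigma_eq : ArithmeticFunction.sigma 1 N = 2 * N
  prime : p.Prime
  special_mod : p % 4 = 1
  special_exp_mod : N.factorization p % 4 = 1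
  even_exp : ∀ q, q.Prime → q ∣ N → q ≠ p → Even (N.factorization q)
  dvd_exp : ∀ q, q.Prime → q ∣ N → q ≠ p → k ∣ N.factorization q + 1

/-- The non-special prime divisors of `N` that are congruent to `1` modulo `l`. -/
def primesOneMod (N p l : ℕ) : Finset ℕ :=
  N.primeFactors.filter fun q => q ≠ p ∧ q ≡ 1 [MOD l]

namespace IsEulerPerfect

variable {N p k l a : ℕ}

theorem ne_zero (E : IsEulerPerfect N p k) : N ≠ 0 := by
  rintro rfl
  exact absurd E.odd (by decide)

theorem mem_primesOneMod (E : IsEulerPerfect N p k) {q : ℕ} :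
    q ∈ primesOneMod N p l ↔ q.Prime ∧ q ∣ N ∧ q ≠ p ∧ q ≡ 1 [MOD l] := by
  simp [primesOneMod, E.ne_zero, and_assoc]

theorem prod_geomSum (E : IsEulerPerfect N p k) :
    ∏ q ∈ N.primeFactors, geomSum q (N.factorization q + 1) = 2 * N := by
  rw [← E.sigma_eq, ArithmeticFunction.IsMultiplicative.multiplicative_factorization _
    ArithmeticFunction.isMultiplicative_sigma E.ne_zero, Finsupp.prod, Nat.support_factorization]
  refine Finset.prod_congr rfl fun q hq => ?_
  rw [ArithmeticFunction.sigma_one_apply_prime_pow (Nat.prime_of_mem_primeFactors hq), geomSum]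

theorem prod_geomSum_dvd (E : IsEulerPerfect N p k) {T : Finset ℕ} (hT : T ⊆ N.primeFactors) :
    ∏ q ∈ T, geomSum q (N.factorization q + 1) ∣ 2 * N := by
  rw [← E.prod_geomSum]
  exact Finset.prod_dvd_prod_of_subset _ _ _ hT

theorem geomSum_dvd (E : IsEulerPerfect N p k) {q : ℕ} (hq : q.Prime) (hqN : q ∣ N) :
    geomSum q (N.factorization q + 1) ∣ 2 * N := by
  have := E.prod_geomSum_dvd (T := {q})
    (by simpa using ⟨hq, hqN, E.ne_zero⟩)
  simpa using this

theorem ne_two (E : IsEulerPerfect N p k) {q : ℕ} (hqN : q ∣ N) : q ≠ 2 := by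
  rintro rfl
  exact absurd (E.odd.of_dvd_nat hqN) (by decide)

theorem three_le (E : IsEulerPerfect N p k) {q : ℕ} (hq : q.Prime) (hqN : q ∣ N) : 3 ≤ q := by
  have := hq.two_le
  have := E.ne_two hqN
  omega

theorem special_dvd (E : IsEulerPerfect N p k) : p ∣ N := by
  by_contra h
  have := E.special_exp_mod
  rw [Nat.factorization_eq_zero_of_not_dvd h] at this
  omega

theorem dvd_of_dvd_geomSum (E : IsEulerPerfect N p k) {q d u : ℕ} (hq : q.Prime) (hqN : q ∣ N)
    (hd : d ∣ N.factorization q + 1) (hu : u.Prime) (hu2 : u ≠ 2) (h : u ∣ geomSum q d) :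
    u ∣ N := by
  have h1 := (h.trans (geomSum_dvd_geomSum q hd)).trans (E.geomSum_dvd hq hqN)
  exact (hu.dvd_mul.mp h1).resolve_left
    fun h2 => hu2 ((Nat.prime_dvd_prime_iff_eq hu Nat.prime_two).mp h2)

theorem dvd_of_dvd_special_add_one (E : IsEulerPerfect N p k) {u : ℕ} (hu : u.Prime)
    (hu2 : u ≠ 2) (h : u ∣ p + 1) : u ∣ N := by
  refine E.dvd_of_dvd_geomSum (d := 2) E.prime E.special_dvd ?_ hu hu2 ?_
  · have := E.special_exp_mod
    omega
  · simpa [geomSum, Finset.sum_range_succ, add_comm] using h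

/-- Since `p ≡ 1 mod 4`, `(p + 1) / 2` is odd and exceeds 1; its prime factors divide `σ(N)`, hence
`N`. -/
theorem exists_prime_lt_special (E : IsEulerPerfect N p k) :
    ∃ q, q.Prime ∧ q ∣ N ∧ q < p := by
  have hmod := E.special_mod
  have hp := E.prime.two_le
  obtain ⟨b, hb⟩ : ∃ b, p = 2 * b + 1 := ⟨p / 2, by omega⟩
  have hq := Nat.minFac_prime (n := b + 1) (by omega)
  have hqd := Nat.minFac_dvd (b + 1)
  have hle := Nat.le_of_dvd (by omega) hqd
  have hq2 : (b + 1).minFac ≠ 2 := by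
    intro h
    rw [h] at hqd
    omega
  refine ⟨_, hq, E.dvd_of_dvd_special_add_one hq hq2 ?_, by omega⟩
  exact hqd.trans ⟨2, by omega⟩

theorem odd_of_dvd_exp (E : IsEulerPerfect N p k) {q d : ℕ} (hq : q.Prime) (hqN : q ∣ N)
    (hqp : q ≠ p) (hd : d ∣ N.factorization q + 1) : Odd d :=
  (E.even_exp q hq hqN hqp).add_one.of_dvd_nat hd

/-- A non-special prime exists, so the divisibility condition is not vacuous; in particular `k ≠ 0`.
-/
theorem odd_modulus (E : IsEulerPerfect N p k) : Odd k := by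
  obtain ⟨q, hq, hqN, hlt⟩ := E.exists_prime_lt_special
  exact E.odd_of_dvd_exp hq hqN hlt.ne (E.dvd_exp q hq hqN hlt.ne)

theorem exists_prime_orderOf (E : IsEulerPerfect N p k) (hl : l.Prime) {q d : ℕ}
    (hq : q.Prime) (hqN : q ∣ N) (hqp : q ≠ p) (hd : d ∣ N.factorization q + 1) (hld : l ∣ d) :
    ∃ u, u.Prime ∧ u ∣ N ∧ u ≡ 1 [MOD l] ∧ orderOf (q : ZMod u) = d := by
  have hdo := E.odd_of_dvd_exp hq hqN hqp hd
  have hlo := hdo.of_dvd_nat hld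
  have hl3 : 3 ≤ l := by
    have := hl.two_le
    have : l ≠ 2 := by rintro rfl; exact absurd hlo (by decide)
    omega
  have hd1 : 1 < d := lt_of_lt_of_le hl.one_lt (Nat.le_of_dvd hdo.pos hld)
  obtain ⟨u, hu, ho⟩ := exists_prime_orderOf_eq (E.three_le hq hqN) hdo hd1
  have h1 := orderOf_natCast_dvd_sub_one (s := q) hu (by omega)
  rw [ho] at h1
  have hlu := hld.trans h1
  have hu2 : u ≠ 2 := by
    rintro rfl
    have := Nat.le_of_dvd (by norm_num) hlu
    omega
  refine ⟨u, hu, ?_, ((Nat.modEq_iff_dvd' hu.one_le).mpr hlu).symm, ho⟩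
  refine E.dvd_of_dvd_geomSum hq hqN hd hu hu2
    (dvd_geomSum_of_orderOf hq.pos hu (by omega) (by rw [ho]))

/-- Each prime counted contributes `l ^ a` to `σ(N) = 2N`, and `l` is odd. -/
theorem mul_card_le (E : IsEulerPerfect N p (l ^ a)) (hl : l.Prime) (ha : a ≠ 0) :
    a * (primesOneMod N p l).card ≤ N.factorization l := by
  have hlo : Odd l := E.odd_modulus.of_dvd_nat (dvd_pow_self l ha)
  rw [← hl.pow_dvd_iff_le_factorization E.ne_zero]
  have hc : Nat.Coprime (l ^ (a * (primesOneMod N p l).card)) 2 :=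
    Nat.Coprime.pow_left _ hlo.coprime_two_right
  have hsub : primesOneMod N p l ⊆ N.primeFactors := Finset.filter_subset _ _
  refine hc.dvd_of_dvd_mul_left (dvd_trans ?_ (E.prod_geomSum_dvd hsub))
  rw [pow_mul, ← Finset.prod_const]
  refine Finset.prod_dvd_prod_of_dvd _ _ fun q hq => ?_
  obtain ⟨h1, h2, h3, h4⟩ := E.mem_primesOneMod.mp hq
  exact pow_dvd_geomSum h4 (E.dvd_exp q h1 h2 h3)

theorem eq_mul_prod (E : IsEulerPerfect N p k) :
    N = p ^ N.factorization p * ∏ q ∈ N.primeFactors.erase p, q ^ N.factorization q := by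
  have hmem : p ∈ N.primeFactors := by simp [E.prime, E.special_dvd, E.ne_zero]
  rw [Finset.mul_prod_erase _ (fun q => q ^ N.factorization q) hmem]
  exact (Nat.prod_factorization_pow_eq_self E.ne_zero).symm

theorem mem_erase (E : IsEulerPerfect N p k) {q : ℕ} :
    q ∈ N.primeFactors.erase p ↔ q.Prime ∧ q ∣ N ∧ q ≠ p := by
  simp [E.ne_zero]; tauto

/-! ### The prime `l` divides `N` -/

theorem eq_special_of_not_dvd (E : IsEulerPerfect N p l) (hl : l.Prime) (hlN : ¬ l ∣ N) {u : ℕ}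
    (hu : u.Prime) (huN : u ∣ N) (h1 : u ≡ 1 [MOD l]) : u = p := by
  by_contra hne
  have hl2 : l ≠ 2 := by rintro rfl; exact absurd E.odd_modulus (by decide)
  refine hlN (E.dvd_of_dvd_geomSum hu huN (E.dvd_exp u hu huN hne) hl hl2 ?_)
  simpa using pow_dvd_geomSum (a := 1) h1 (by simp)

/-- The Zsigmondy primes for the lengths `l` and `N.factorization q + 1` must both be `p`, so both
lengths equal the order of `q` mod `p`. -/
theorem factorization_add_one_of_not_dvd (E : IsEulerPerfect N p l) (hl : l.Prime)
    (hlN : ¬ l ∣ N) {q : ℕ} (hq : q.Prime) (hqN : q ∣ N) (hqp : q ≠ p) :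
    N.factorization q + 1 = l := by
  have hd := E.dvd_exp q hq hqN hqp
  obtain ⟨u, hu, huN, hu1, ho⟩ := E.exists_prime_orderOf hl hq hqN hqp hd dvd_rfl
  obtain ⟨v, hv, hvN, hv1, ho'⟩ := E.exists_prime_orderOf hl hq hqN hqp dvd_rfl hd
  rw [E.eq_special_of_not_dvd hl hlN hu huN hu1] at ho
  rw [E.eq_special_of_not_dvd hl hlN hv hvN hv1] at ho'
  omega

theorem exists_geomSum_eq_pow (E : IsEulerPerfect N p l) (hl : l.Prime)
    (hlN : ¬ l ∣ N) {q : ℕ} (hq : q.Prime) (hqN : q ∣ N) (hqp : q ≠ p) :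
    ∃ x, geomSum q l = p ^ x := by
  have hl2 : l ≠ 2 := by rintro rfl; exact absurd E.odd_modulus (by decide)
  have hd := E.dvd_exp q hq hqN hqp
  refine ⟨_, Nat.eq_prime_pow_of_unique_prime_dvd (geomSum_pos q hl.pos).ne' ?_⟩
  intro u hu hdu
  have hu2 : u ≠ 2 := by
    rintro rfl
    rcases eq_or_modEq_one_of_dvd_geomSum (a := 1) hq.pos hl hu (by simpa using hdu) with h | h
    · exact hl2 h.symm
    · have := (Nat.modEq_iff_dvd' (by norm_num)).mp h.symm
      exact hl.one_lt.ne' (by simpa using this)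
  have huN := E.dvd_of_dvd_geomSum hq hqN hd hu hu2 hdu
  rcases eq_or_modEq_one_of_dvd_geomSum (a := 1) hq.pos hl hu (by simpa using hdu) with h | h
  · exact absurd (h ▸ huN) hlN
  · exact E.eq_special_of_not_dvd hl hlN hu huN h

/-- `p ^ x - 1 = q + ⋯ + q ^ (l - 1)` has `q`-valuation exactly 1, so lifting the exponent gives `p
^ (x * n) - 1` valuation `1 + padicValNat q n`. It is a multiple of `p ^ n - 1`, hence of `q ^ (l -
1)`. -/
theorem pow_dvd_special_exp_add_one {q x n : ℕ} (hq : q.Prime) (hq2 : Odd q) (hp : 1 < p)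
    (hl : 3 ≤ l) (hx : geomSum q l = p ^ x) (hn : 0 < n)
    (h : q ^ (l - 1) ∣ geomSum p n) : q ^ (l - 2) ∣ n := by
  have := Fact.mk hq
  obtain ⟨m, rfl⟩ : ∃ m, l = m + 2 := ⟨l - 2, by omega⟩
  have hsub : p ^ x - 1 = q * geomSum q (m + 1) := by
    rw [← hx, geomSum, Finset.sum_range_succ', geomSum, Finset.mul_sum, pow_zero,
      Nat.add_sub_cancel]
    exact Finset.sum_congr rfl fun i _ => by ring
  have hpos : 0 < geomSum q (m + 1) := geomSum_pos q (Nat.succ_pos m)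
  have hxpos : 1 < p ^ x := by
    have := Nat.mul_pos hq.pos hpos
    omega
  have hval : padicValNat q (p ^ x - 1) = 1 := by
    rw [hsub, padicValNat.mul hq.ne_zero hpos.ne', padicValNat_self,
      padicValNat.eq_zero_of_not_dvd]
    exact hq.coprime_iff_not_dvd.mp (geomSum_coprime q m)
  have hnd : ¬ q ∣ p ^ x := by
    rw [← hx]
    exact hq.coprime_iff_not_dvd.mp (geomSum_coprime q (m + 1))
  have hlte := padicValNat.pow_sub_pow hq2 hxpos (x := p ^ x) (y := 1)
    (by rw [hsub]; exact Dvd.intro _ rfl) hnd (n := n) hn.ne'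
  rw [one_pow, hval] at hlte
  have hbig : 1 < (p ^ x) ^ n := Nat.one_lt_pow hn.ne' hxpos
  have hdvd : q ^ (m + 1) ∣ (p ^ x) ^ n - 1 := by
    have h1 : q ^ (m + 1) ∣ p ^ n - 1 := by
      rw [← geomSum_mul_sub_one (by omega)]
      exact (show m + 2 - 1 = m + 1 by omega) ▸ h.mul_right _
    refine h1.trans ?_
    rw [← pow_mul, mul_comm, pow_mul]
    simpa using Nat.sub_dvd_pow_sub_pow (p ^ n) 1 x
  have hle := (padicValNat_dvd_iff_le (by omega)).mp hdvd
  rw [show m + 2 - 2 = m by omega, padicValNat_dvd_iff_le hn.ne']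
  omega

theorem two_mul_sq_lt_five_pow {n : ℕ} (hn : 2 ≤ n) : 2 * (n + 1) ^ 2 < 5 ^ n := by
  induction n, hn using Nat.le_induction with
  | base => norm_num
  | succ n hn ih => rw [pow_succ 5]; nlinarith

/-- A prime dividing all `e + 1`, for `e` a non-special exponent of `N`, divides `N`. -/
theorem dvd_of_dvd_exp (E : IsEulerPerfect N p l) (hl : l.Prime) : l ∣ N := by
  by_contra hlN
  have hl3 : 3 ≤ l := by
    have := hl.two_le
    have : l ≠ 2 := by rintro rfl; exact absurd E.odd_modulus (by decide)
    omega
  set P := N.primeFactors.erase p with hP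
  set n := N.factorization p with hn
  have hexp : ∀ q ∈ P, N.factorization q = l - 1 := fun q hq => by
    obtain ⟨h1, h2, h3⟩ := E.mem_erase.mp hq
    have := E.factorization_add_one_of_not_dvd hl hlN h1 h2 h3
    omega
  have hNeq : N = p ^ n * (∏ q ∈ P, q) ^ (l - 1) := by
    rw [← Finset.prod_pow]
    conv_lhs => rw [E.eq_mul_prod]
    congr 1
    exact Finset.prod_congr rfl fun q hq => by rw [hexp q hq]
  have h2N : geomSum p (n + 1) * ∏ q ∈ P, geomSum q l = 2 * N := by
    have hmem : p ∈ N.primeFactors := by simp [E.prime, E.special_dvd, E.ne_zero]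
    rw [← E.prod_geomSum, ← Finset.mul_prod_erase _ _ hmem]
    congr 1
    refine Finset.prod_congr rfl fun q hq => ?_
    rw [hexp q hq, Nat.sub_add_cancel hl.one_le]
  have hdvd : ∀ q ∈ P, q ^ (l - 2) ∣ n + 1 := fun q hq => by
    obtain ⟨h1, h2, h3⟩ := E.mem_erase.mp hq
    obtain ⟨x, hx⟩ := E.exists_geomSum_eq_pow hl hlN h1 h2 h3
    refine pow_dvd_special_exp_add_one h1 (E.odd.of_dvd_nat h2) E.prime.one_lt hl3 hx
      n.succ_pos ?_
    -- The non-special `σ`-factors are powers of `p`, so all of `q ^ (l - 1)` must come from `σ(p ^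
    -- n)`.
    have hc : Nat.Coprime (q ^ (l - 1)) (∏ q ∈ P, geomSum q l) := by
      refine Nat.Coprime.prod_right fun r hr => ?_
      obtain ⟨h1', h2', h3'⟩ := E.mem_erase.mp hr
      obtain ⟨y, hy⟩ := E.exists_geomSum_eq_pow hl hlN h1' h2' h3'
      rw [hy]
      exact Nat.Coprime.pow _ _ ((Nat.coprime_primes h1 E.prime).mpr h3)
    refine hc.dvd_of_dvd_mul_right ?_
    rw [h2N, ← hexp q hq]
    exact (Nat.ordProj_dvd N q).mul_left 2
  have hM : (∏ q ∈ P, q) ^ (l - 2) ∣ n + 1 := by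
    rw [← Finset.prod_pow]
    refine Finset.prod_dvd_of_isRelPrime ?_ hdvd
    intro q hq r hr hne
    obtain ⟨h1, -, -⟩ := E.mem_erase.mp hq
    obtain ⟨h1', -, -⟩ := E.mem_erase.mp hr
    exact Nat.coprime_iff_isRelPrime.mp
      (Nat.Coprime.pow _ _ ((Nat.coprime_primes h1 h1').mpr hne))
  have hM3 : 3 ≤ ∏ q ∈ P, q := by
    obtain ⟨q, hq, hqN, hlt⟩ := E.exists_prime_lt_special
    have hqP : q ∈ P := E.mem_erase.mpr ⟨hq, hqN, hlt.ne⟩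
    refine (E.three_le hq hqN).trans (Nat.le_of_dvd ?_ (Finset.dvd_prod_of_mem _ hqP))
    exact Finset.prod_pos fun r hr => (E.mem_erase.mp hr).1.pos
  set M := ∏ q ∈ P, q with hMdef
  have hMle : M ^ (l - 2) ≤ n + 1 := Nat.le_of_dvd n.succ_pos hM
  have hM3' : 3 ≤ M ^ (l - 2) := by
    calc 3 ≤ M := hM3
      _ = M ^ 1 := (pow_one M).symm
      _ ≤ M ^ (l - 2) := Nat.pow_le_pow_right (by omega) (by omega)
  -- `l - 1 ≤ 2 * (l - 2)` because `l ≥ 3`. The contradiction will be `5 ^ n ≤ p ^ n ≤ 2 * M ^ (l -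
  -- 1) ≤ 2 * (n + 1) ^ 2 < 5 ^ n`.
  have hsq : M ^ (l - 1) ≤ (n + 1) ^ 2 := by
    calc M ^ (l - 1) ≤ M ^ ((l - 2) * 2) := Nat.pow_le_pow_right (by omega) (by omega)
      _ = (M ^ (l - 2)) ^ 2 := pow_mul _ _ _
      _ ≤ (n + 1) ^ 2 := Nat.pow_le_pow_left hMle 2
  have hle : p ^ n ≤ 2 * M ^ (l - 1) := by
    refine (pow_le_geomSum p n).trans (Nat.le_of_dvd (by positivity) ?_)
    have hc : Nat.Coprime (geomSum p (n + 1)) (p ^ n) :=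
      (Nat.Coprime.pow_left n (geomSum_coprime p n)).symm
    refine hc.dvd_of_dvd_mul_left (dvd_trans (Dvd.intro _ h2N) ?_)
    conv_lhs => rw [hNeq]
    exact dvd_of_eq (by ring)
  have hp5 : 5 ≤ p := by
    have := E.special_mod
    have := E.prime.two_le
    omega
  have h5 : 5 ^ n ≤ p ^ n := Nat.pow_le_pow_left hp5 n
  have := two_mul_sq_lt_five_pow (n := n) (by omega)
  omega

/-! ### The case of the special prime -/

/-- The Zsigmondy primes for different `d ∈ T` differ, having different orders; `s` itself is one
more prime of the set. -/
theorem card_lt_card_primesOneMod (E : IsEulerPerfect N p k) {s : ℕ} (hs : s.Prime)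
    (hsN : s ∣ N) (hsp : s ≠ p) (hs1 : s ≡ 1 [MOD p]) {T : Finset ℕ}
    (hT : ∀ d ∈ T, d ∣ N.factorization s + 1 ∧ p ∣ d) :
    T.card < (primesOneMod N p p).card := by
  have hex : ∀ d : ℕ, ∃ u : ℕ, d ∈ T → u.Prime ∧ u ∣ N ∧ u ≡ 1 [MOD p] ∧
      orderOf (s : ZMod u) = d := fun d => by
    by_cases hd : d ∈ T
    · obtain ⟨u, hu⟩ := E.exists_prime_orderOf E.prime hs hsN hsp (hT d hd).1 (hT d hd).2
      exact ⟨u, fun _ => hu⟩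
    · exact ⟨0, fun h => absurd h hd⟩
  choose u hu using hex
  have hinj : Set.InjOn u T := fun c hc d hd hcd => by
    rw [← (hu c hc).2.2.2, ← (hu d hd).2.2.2, hcd]
  have hmem : s ∈ primesOneMod N p p := E.mem_primesOneMod.mpr ⟨hs, hsN, hsp, hs1⟩
  rw [← Finset.card_image_of_injOn hinj]
  refine Finset.card_lt_card ((Finset.ssubset_iff_of_subset ?_).mpr ⟨s, hmem, ?_⟩)
  · intro v hv
    obtain ⟨d, hd, rfl⟩ := Finset.mem_image.mp hv
    obtain ⟨h1, h2, h3, -⟩ := hu d hd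
    refine E.mem_primesOneMod.mpr ⟨h1, h2, fun h => ?_, h3⟩
    rw [h] at h3
    have := (Nat.modEq_iff_dvd' E.prime.one_le).mp h3.symm
    have := Nat.le_of_dvd (Nat.sub_pos_of_lt E.prime.one_lt) this
    have := E.prime.pos
    omega
  · intro hv
    obtain ⟨d, hd, hds⟩ := Finset.mem_image.mp hv
    have ho := (hu d hd).2.2.2
    have := Fact.mk hs
    -- Were `s` its own Zsigmondy prime, its order would be the default 0, which does not divide the
    -- positive `N.factorization s + 1`.
    rw [hds, CharP.cast_eq_zero, orderOf_zero] at ho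
    have h1 := (hT d hd).1
    rw [← ho, zero_dvd_iff] at h1
    omega

theorem two_le_card_primesOneMod (E : IsEulerPerfect N p k) (hk : p ∣ k) :
    2 ≤ (primesOneMod N p p).card := by
  obtain ⟨q, hq, hqN, hlt⟩ := E.exists_prime_lt_special
  obtain ⟨u, hu, huN, hu1, -⟩ := E.exists_prime_orderOf E.prime hq hqN hlt.ne
    (hk.trans (E.dvd_exp q hq hqN hlt.ne)) dvd_rfl
  have hup : u ≠ p := by
    rintro rfl
    have := (Nat.modEq_iff_dvd' hu.one_le).mp hu1.symm
    have := Nat.le_of_dvd (Nat.sub_pos_of_lt hu.one_lt) this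
    have := hu.pos
    omega
  have := E.card_lt_card_primesOneMod hu huN hup hu1 (T := {p}) (by
    simpa using hk.trans (E.dvd_exp u hu huN hup))
  rw [Finset.card_singleton] at this
  omega

theorem exists_factorization_add_one_eq_pow (E : IsEulerPerfect N p k) (hk : p ^ 2 ∣ k)
    (hcard : (primesOneMod N p p).card ≤ 4) {s : ℕ} (hs : s.Prime)
    (hsN : s ∣ N) (hsp : s ≠ p) (hs1 : s ≡ 1 [MOD p]) :
    ∃ v, N.factorization s + 1 = p ^ v := by
  obtain ⟨v, m, hpm, hv⟩ := Nat.exists_eq_pow_mul_and_not_dvd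
    (n := N.factorization s + 1) (by omega) p E.prime.ne_one
  have hd : p ^ 2 ∣ N.factorization s + 1 := hk.trans (E.dvd_exp s hs hsN hsp)
  have hp2 := E.prime.two_le
  by_cases hm1 : m = 1
  · exact ⟨v, by rw [hv, hm1, mul_one]⟩
  exfalso
  have hd2 : p ^ 2 * m ∣ N.factorization s + 1 := by
    refine Nat.Coprime.mul_dvd_of_dvd_of_dvd ?_ hd ⟨p ^ v, by rw [hv, mul_comm]⟩
    exact Nat.Coprime.pow_left 2 (E.prime.coprime_iff_not_dvd.mpr hpm)
  have hd1 : p * m ∣ N.factorization s + 1 :=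
    (mul_dvd_mul_right (dvd_pow_self p two_ne_zero) m).trans hd2
  -- A cofactor `m ≠ 1` yields four distinct multiples of `p` dividing the exponent plus one, hence
  -- at least five primes.
  have hlt := E.card_lt_card_primesOneMod hs hsN hsp hs1
    (T := {p, p ^ 2, p * m, p ^ 2 * m}) (by
      intro d hdm
      simp only [Finset.mem_insert, Finset.mem_singleton] at hdm
      rcases hdm with rfl | rfl | rfl | rfl
      · exact ⟨(dvd_pow_self _ two_ne_zero).trans hd, dvd_rfl⟩
      · exact ⟨hd, dvd_pow_self p two_ne_zero⟩
      · exact ⟨hd1, Dvd.intro _ rfl⟩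
      · exact ⟨hd2, (dvd_pow_self p two_ne_zero).mul_right m⟩)
  have hmp : m ≠ p := by rintro rfl; exact hpm dvd_rfl
  have hm0 : m ≠ 0 := by rintro rfl; exact hpm (dvd_zero p)
  have hp0 : p ≠ 0 := E.prime.ne_zero
  have e1 : p ≠ p ^ 2 := by nlinarith
  have e2 : p ≠ p * m := fun h => hm1 (Nat.eq_of_mul_eq_mul_left E.prime.pos (by linarith))
  have e3 : p ≠ p ^ 2 * m := fun h => by
    have : p * m = 1 := Nat.eq_of_mul_eq_mul_left E.prime.pos (by linarith)
    exact hm1 (Nat.eq_one_of_mul_eq_one_left this)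
  have e4 : p ^ 2 ≠ p * m := fun h =>
    hmp (Nat.eq_of_mul_eq_mul_left E.prime.pos (by linarith))
  have e5 : p ^ 2 ≠ p ^ 2 * m := fun h =>
    hm1 (Nat.eq_of_mul_eq_mul_left (pow_pos E.prime.pos 2) (by linarith))
  have e6 : p * m ≠ p ^ 2 * m := fun h =>
    e1 (Nat.eq_of_mul_eq_mul_right (Nat.pos_of_ne_zero hm0) h)
  rw [Finset.card_insert_of_notMem (by simp [*]), Finset.card_insert_of_notMem (by simp [*]),
    Finset.card_insert_of_notMem (by simpa using e6), Finset.card_singleton] at hlt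
  omega

theorem pow_five_le_three_pow {x : ℕ} (hx : 24 ≤ x) : (x + 1) ^ 5 ≤ 3 ^ x := by
  induction x, hx using Nat.le_induction with
  | base => norm_num
  | succ x hx ih =>
    have h : (x + 1 + 1) ^ 5 ≤ 3 * (x + 1) ^ 5 := by
      obtain ⟨y, rfl⟩ : ∃ y, x = y + 24 := ⟨x - 24, by omega⟩
      ring_nf
      gcongr <;> omega
    rw [pow_succ 3]
    omega

theorem special_mul_le_of_two_le (E : IsEulerPerfect N p (p ^ a)) (ha : 2 ≤ a) :
    5 * a ≤ N.factorization p := by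
  by_contra! hlt
  set n := N.factorization p with hn
  set S := primesOneMod N p p with hS
  have hp5 : 5 ≤ p := by
    have := E.special_mod
    have := E.prime.two_le
    omega
  have hcard : S.card ≤ 4 := by
    have h1 : a * S.card ≤ n := E.mul_card_le E.prime (by omega)
    have h2 : a * S.card < a * 5 := by omega
    have := Nat.lt_of_mul_lt_mul_left h2
    omega
  obtain ⟨q, hq, hqN, hqp⟩ := E.exists_prime_lt_special
  have hq1 : ¬ q ≡ 1 [MOD p] := fun h => by
    have := (Nat.modEq_iff_dvd' hq.one_le).mp h.symm
    have := Nat.le_of_dvd (Nat.sub_pos_of_lt hq.one_lt) this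
    omega
  have hqS : q ∉ S := fun h => hq1 (E.mem_primesOneMod.mp h).2.2.2
  set A := ∏ s ∈ S, s ^ N.factorization s with hA
  -- All prime factors of `L` are `p` or 1 mod `p`, so `L` divides the part `p ^ n * A` of `N`. The
  -- `σ`-factors over `S` already exceed `A`, leaving `geomSum q (p ^ a) ≤ p ^ n < (p ^ a) ^ 5`,
  -- absurd since `q ≥ 3` and `p ^ a ≥ 25`.
  set L := (∏ s ∈ S, geomSum s (N.factorization s + 1)) * geomSum q (p ^ a) with hL
  have hL2N : L ∣ 2 * N := by
    have hsub : insert q S ⊆ N.primeFactors := by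
      intro x hx
      rcases Finset.mem_insert.mp hx with rfl | hx
      · simpa using ⟨hq, hqN, E.ne_zero⟩
      · exact Finset.filter_subset _ _ hx
    refine dvd_trans ?_ (E.prod_geomSum_dvd hsub)
    rw [Finset.prod_insert hqS, mul_comm]
    exact mul_dvd_mul_left _ (geomSum_dvd_geomSum q (E.dvd_exp q hq hqN hqp.ne))
  have hLprime : ∀ u : ℕ, u.Prime → u ∣ L → u = p ∨ u ≡ 1 [MOD p] := fun u hu huL => by
    rcases hu.dvd_mul.mp huL with h | h
    · obtain ⟨s, hsS, hus⟩ := (hu.prime.dvd_finsetProd_iff _).mp h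
      obtain ⟨h1, h2, h3, h4⟩ := E.mem_primesOneMod.mp hsS
      obtain ⟨v, hv⟩ := E.exists_factorization_add_one_eq_pow (pow_dvd_pow p ha) hcard h1 h2 h3 h4
      rw [hv] at hus
      exact eq_or_modEq_one_of_dvd_geomSum h1.pos E.prime hu hus
    · exact eq_or_modEq_one_of_dvd_geomSum hq.pos E.prime hu h
  set C := ∏ r ∈ (N.primeFactors.erase p) \ S, r ^ N.factorization r with hC
  have hsplit : N = p ^ n * (C * A) := by
    conv_lhs => rw [E.eq_mul_prod]
    congr 1
    refine (Finset.prod_sdiff fun x hx => ?_).symm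
    obtain ⟨h1, h2, h3, -⟩ := E.mem_primesOneMod.mp hx
    exact E.mem_erase.mpr ⟨h1, h2, h3⟩
  have hco : Nat.Coprime L (2 * C) := by
    refine Nat.Coprime.symm (Nat.coprime_of_dvd fun u hu h1 h2 => ?_)
    have hcase := hLprime u hu h2
    rcases hu.dvd_mul.mp h1 with h | h
    · have hu2 := (Nat.prime_dvd_prime_iff_eq hu Nat.prime_two).mp h
      subst hu2
      rcases hcase with h | h
      · omega
      · have := (Nat.modEq_iff_dvd' (by norm_num)).mp h.symm
        have := Nat.le_of_dvd (by norm_num) this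
        omega
    · obtain ⟨r, hr, hur⟩ := (hu.prime.dvd_finsetProd_iff _).mp h
      obtain ⟨hr1, hr2⟩ := Finset.mem_sdiff.mp hr
      obtain ⟨h3, h4, h5⟩ := E.mem_erase.mp hr1
      have hur' := (Nat.prime_dvd_prime_iff_eq hu h3).mp (hu.dvd_of_dvd_pow hur)
      subst hur'
      rcases hcase with h | h
      · exact h5 h
      · exact hr2 (E.mem_primesOneMod.mpr ⟨h3, h4, h5, h⟩)
  have hdvd : L ∣ p ^ n * A := by
    refine hco.dvd_of_dvd_mul_left (hL2N.trans (dvd_of_eq ?_))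
    conv_lhs => rw [hsplit]
    ring
  have hApos : 0 < A := Finset.prod_pos fun s hs =>
    pow_pos (E.mem_primesOneMod.mp hs).1.pos _
  have hle := Nat.le_of_dvd (Nat.mul_pos (pow_pos E.prime.pos n) hApos) hdvd
  have hAle : A ≤ ∏ s ∈ S, geomSum s (N.factorization s + 1) :=
    Finset.prod_le_prod' fun s _ => pow_le_geomSum s _
  have hpa : 25 ≤ p ^ a := by
    calc 25 = 5 ^ 2 := by norm_num
      _ ≤ p ^ 2 := Nat.pow_le_pow_left hp5 2
      _ ≤ p ^ a := Nat.pow_le_pow_right (by omega) ha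
  have h3 : 3 ^ (p ^ a - 1) ≤ geomSum q (p ^ a) := by
    have := pow_le_geomSum q (p ^ a - 1)
    rw [Nat.sub_add_cancel (by omega)] at this
    exact (Nat.pow_le_pow_left (E.three_le hq hqN) _).trans this
  have h4 : A * 3 ^ (p ^ a - 1) ≤ A * p ^ n := by
    calc A * 3 ^ (p ^ a - 1) ≤ L := Nat.mul_le_mul hAle h3
      _ ≤ A * p ^ n := by linarith
  have h5 := Nat.le_of_mul_le_mul_left h4 hApos
  have h6 := pow_five_le_three_pow (x := p ^ a - 1) (by omega)
  rw [Nat.sub_add_cancel (by omega), ← pow_mul] at h6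
  have h7 : p ^ n < p ^ (a * 5) := Nat.pow_lt_pow_right E.prime.one_lt (by omega)
  omega

theorem special_mul_le (E : IsEulerPerfect N p (p ^ a)) : 5 * a ≤ N.factorization p := by
  rcases Nat.lt_or_ge a 2 with ha | ha
  · interval_cases a
    · omega
    · have h1 := E.two_le_card_primesOneMod (by simp)
      have h2 := E.mul_card_le E.prime (by omega)
      have := E.special_exp_mod
      -- The exponent is at least 2 and is 1 mod 4, hence at least 5.
      omega
  · exact E.special_mul_le_of_two_le ha

/-! ### Small exponents of `3` and `5` -/

theorem dvd_of_dvd_geomSum_of_dvd (E : IsEulerPerfect N p k) {q d u : ℕ} (hq : q.Prime)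
    (hqN : q ∣ N) (hqp : q ≠ p) (hd : d ∣ k) (hu : u.Prime) (hu2 : u ≠ 2)
    (h : u ∣ geomSum q d) : u ∣ N :=
  E.dvd_of_dvd_geomSum hq hqN (hd.trans (E.dvd_exp q hq hqN hqp)) hu hu2 h

theorem card_le_of_forall_mem (E : IsEulerPerfect N p k) {T : Finset ℕ}
    (hT : ∀ q ∈ T, q.Prime ∧ q ∣ N ∧ q ≠ p ∧ q ≡ 1 [MOD l]) :
    T.card ≤ (primesOneMod N p l).card :=
  Finset.card_le_card fun q hq => E.mem_primesOneMod.mpr (hT q hq)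

/-- Exponent 4 allows at most four non-special primes 1 mod 5. Factoring `σ(q ^ 4)` from `q = 5`
onwards produces six, of which at most one is special; the bases 11, 71 and 211 are 3 mod 4, so
never special. -/
theorem factorization_five_ne_four (E : IsEulerPerfect N p 5) (h5p : 5 ≠ p) :
    N.factorization 5 ≠ 4 := by
  intro hv
  have h5 : 5 ∣ N := by
    by_contra h
    rw [Nat.factorization_eq_zero_of_not_dvd h] at hv
    omega
  have hcard : (primesOneMod N p 5).card ≤ 4 := by
    have := mul_card_le (l := 5) (a := 1) (by simpa using E) (by norm_num) (by norm_num)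
    omega
  have hne : ∀ q, q % 4 = 3 → q ≠ p := by
    rintro q h rfl
    have := E.special_mod
    omega
  have step : ∀ q u : ℕ, q.Prime → q ∣ N → q ≠ p → u.Prime → u ≠ 2 → u ∣ geomSum q 5 → u ∣ N :=
    fun q u hq hqN hqp hu hu2 h => E.dvd_of_dvd_geomSum_of_dvd hq hqN hqp dvd_rfl hu hu2 h
  have h11 : 11 ∣ N := step 5 11 (by norm_num) h5 h5p (by norm_num) (by norm_num)
    (by decide +kernel)
  have h71 : 71 ∣ N := step 5 71 (by norm_num) h5 h5p (by norm_num) (by norm_num)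
    (by decide +kernel)
  have h3221 : 3221 ∣ N := step 11 3221 (by norm_num) h11 (hne _ rfl) (by norm_num) (by norm_num)
    (by decide +kernel)
  have h211 : 211 ∣ N := step 71 211 (by norm_num) h71 (hne _ rfl) (by norm_num) (by norm_num)
    (by decide +kernel)
  have h2221 : 2221 ∣ N := step 71 2221 (by norm_num) h71 (hne _ rfl) (by norm_num) (by norm_num)
    (by decide +kernel)
  have h1361 : 1361 ∣ N := step 211 1361 (by norm_num) h211 (hne _ rfl) (by norm_num) (by norm_num)
    (by decide +kernel)
  have hle := E.card_le_of_forall_mem (l := 5)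
    (T := ({11, 71, 3221, 211, 2221, 1361} : Finset ℕ).erase p) (by
      intro q hq
      simp only [Finset.mem_erase, Finset.mem_insert, Finset.mem_singleton] at hq
      obtain ⟨hqp, rfl | rfl | rfl | rfl | rfl | rfl⟩ := hq <;>
        exact ⟨by norm_num, by assumption, hqp, by decide⟩)
  have := Finset.pred_card_le_card_erase (s := ({11, 71, 3221, 211, 2221, 1361} : Finset ℕ))
    (a := p)
  exact absurd (this.trans (hle.trans hcard)) (by decide)

/-- The chain 3, 13, 61, 97 gives three primes 1 mod 3 where only two are allowed. If `p` lies in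
the chain, a prime factor of `p + 1` restarts or completes it. -/
theorem factorization_three_ne_two (E : IsEulerPerfect N p 3) (h3p : 3 ≠ p) :
    N.factorization 3 ≠ 2 := by
  intro hv
  have h3 : 3 ∣ N := by
    by_contra h
    rw [Nat.factorization_eq_zero_of_not_dvd h] at hv
    omega
  have hcard : (primesOneMod N p 3).card ≤ 2 := by
    have := mul_card_le (l := 3) (a := 1) (by simpa using E) (by norm_num) (by norm_num)
    omega
  have step : ∀ q u : ℕ, q.Prime → q ∣ N → q ≠ p → u.Prime → u ≠ 2 → u ∣ geomSum q 3 → u ∣ N :=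
    fun q u hq hqN hqp hu hu2 h => E.dvd_of_dvd_geomSum_of_dvd hq hqN hqp dvd_rfl hu hu2 h
  have h13 : 13 ∣ N := step 3 13 (by norm_num) h3 h3p (by norm_num) (by norm_num)
    (by decide +kernel)
  obtain ⟨T, hT, hT3⟩ : ∃ T : Finset ℕ,
      (∀ q ∈ T, q.Prime ∧ q ∣ N ∧ q ≠ p ∧ q ≡ 1 [MOD 3]) ∧ 3 ≤ T.card := by
    by_cases hp13 : p = 13
    · subst hp13
      have h7 : 7 ∣ N := E.dvd_of_dvd_special_add_one (by norm_num) (by norm_num) (by norm_num)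
      have h19 : 19 ∣ N := step 7 19 (by norm_num) h7 (by norm_num) (by norm_num) (by norm_num)
        (by decide +kernel)
      have h127 : 127 ∣ N := step 19 127 (by norm_num) h19 (by norm_num) (by norm_num) (by norm_num)
        (by decide +kernel)
      refine ⟨{7, 19, 127}, fun q hq => ?_, by decide⟩
      simp only [Finset.mem_insert, Finset.mem_singleton] at hq
      obtain rfl | rfl | rfl := hq <;>
        exact ⟨by norm_num, by assumption, by norm_num, by decide⟩
    have h61 : 61 ∣ N := step 13 61 (by norm_num) h13 (Ne.symm hp13) (by norm_num) (by norm_num)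
      (by decide +kernel)
    by_cases hp61 : p = 61
    · subst hp61
      have h31 : 31 ∣ N := E.dvd_of_dvd_special_add_one (by norm_num) (by norm_num) (by norm_num)
      have h331 : 331 ∣ N := step 31 331 (by norm_num) h31 (by norm_num) (by norm_num) (by norm_num)
        (by decide +kernel)
      refine ⟨{13, 31, 331}, fun q hq => ?_, by decide⟩
      simp only [Finset.mem_insert, Finset.mem_singleton] at hq
      obtain rfl | rfl | rfl := hq <;>
        exact ⟨by norm_num, by assumption, by norm_num, by decide⟩
    have h97 : 97 ∣ N := step 61 97 (by norm_num) h61 (Ne.symm hp61) (by norm_num) (by norm_num)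
      (by decide +kernel)
    by_cases hp97 : p = 97
    · subst hp97
      have h7 : 7 ∣ N := E.dvd_of_dvd_special_add_one (by norm_num) (by norm_num) (by norm_num)
      refine ⟨{13, 61, 7}, fun q hq => ?_, by decide⟩
      simp only [Finset.mem_insert, Finset.mem_singleton] at hq
      obtain rfl | rfl | rfl := hq <;>
        exact ⟨by norm_num, by assumption, by norm_num, by decide⟩
    · refine ⟨{13, 61, 97}, fun q hq => ?_, by decide⟩
      simp only [Finset.mem_insert, Finset.mem_singleton] at hq
      obtain rfl | rfl | rfl := hq <;>
        exact ⟨by norm_num, by assumption, Ne.symm (by assumption), by decide⟩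
  exact absurd (hT3.trans ((E.card_le_of_forall_mem hT).trans hcard)) (by norm_num)

/-- The same chase with length 9: at most four non-special primes 1 mod 3 are allowed, and five are
found. -/
theorem factorization_three_ne_eight (E : IsEulerPerfect N p 9) (h3p : 3 ≠ p) :
    N.factorization 3 ≠ 8 := by
  intro hv
  have h3 : 3 ∣ N := by
    by_contra h
    rw [Nat.factorization_eq_zero_of_not_dvd h] at hv
    omega
  have hcard : (primesOneMod N p 3).card ≤ 4 := by
    have := mul_card_le (l := 3) (a := 2) (by simpa using E) (by norm_num) (by norm_num)
    omega
  have step : ∀ q u : ℕ, q.Prime → q ∣ N → q ≠ p → u.Prime → u ≠ 2 → u ∣ geomSum q 9 → u ∣ N :=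
    fun q u hq hqN hqp hu hu2 h => E.dvd_of_dvd_geomSum_of_dvd hq hqN hqp dvd_rfl hu hu2 h
  have h13 : 13 ∣ N := step 3 13 (by norm_num) h3 h3p (by norm_num) (by norm_num)
    (by decide +kernel)
  have h757 : 757 ∣ N := step 3 757 (by norm_num) h3 h3p (by norm_num) (by norm_num)
    (by decide +kernel)
  obtain ⟨T, hT, hT5⟩ : ∃ T : Finset ℕ,
      (∀ q ∈ T, q.Prime ∧ q ∣ N ∧ q ≠ p ∧ q ≡ 1 [MOD 3]) ∧ 5 ≤ T.card := by
    by_cases hp13 : p = 13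
    · subst hp13
      have h7 : 7 ∣ N := E.dvd_of_dvd_special_add_one (by norm_num) (by norm_num) (by norm_num)
      have h19 : 19 ∣ N := step 7 19 (by norm_num) h7 (by norm_num) (by norm_num) (by norm_num)
        (by decide +kernel)
      have h37 : 37 ∣ N := step 7 37 (by norm_num) h7 (by norm_num) (by norm_num) (by norm_num)
        (by decide +kernel)
      have h1063 : 1063 ∣ N := step 7 1063 (by norm_num) h7 (by norm_num) (by norm_num)
        (by norm_num) (by decide +kernel)
      refine ⟨{7, 19, 37, 1063, 757}, fun q hq => ?_, by decide⟩
      simp only [Finset.mem_insert, Finset.mem_singleton] at hq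
      obtain rfl | rfl | rfl | rfl | rfl := hq <;>
        exact ⟨by norm_num, by assumption, by norm_num, by decide⟩
    have h61 : 61 ∣ N := step 13 61 (by norm_num) h13 (Ne.symm hp13) (by norm_num) (by norm_num)
      (by decide +kernel)
    have hbig : 1609669 ∣ N := step 13 1609669 (by norm_num) h13 (Ne.symm hp13) (by norm_num)
      (by norm_num) (by decide +kernel)
    by_cases hp757 : p = 757
    · subst hp757
      have h379 : 379 ∣ N := E.dvd_of_dvd_special_add_one (by norm_num) (by norm_num) (by norm_num)
      have h97 : 97 ∣ N := step 61 97 (by norm_num) h61 (by norm_num) (by norm_num) (by norm_num)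
        (by decide +kernel)
      refine ⟨{379, 61, 13, 1609669, 97}, fun q hq => ?_, by decide⟩
      simp only [Finset.mem_insert, Finset.mem_singleton] at hq
      obtain rfl | rfl | rfl | rfl | rfl := hq <;>
        exact ⟨by norm_num, by assumption, by norm_num, by decide⟩
    have h14713 : 14713 ∣ N := step 757 14713 (by norm_num) h757 (Ne.symm hp757) (by norm_num)
      (by norm_num) (by decide +kernel)
    by_cases hp61 : p = 61
    · subst hp61
      have h31 : 31 ∣ N := E.dvd_of_dvd_special_add_one (by norm_num) (by norm_num) (by norm_num)
      refine ⟨{13, 757, 1609669, 14713, 31}, fun q hq => ?_, by decide⟩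
      simp only [Finset.mem_insert, Finset.mem_singleton] at hq
      obtain rfl | rfl | rfl | rfl | rfl := hq <;>
        exact ⟨by norm_num, by assumption, by norm_num, by decide⟩
    have h97 : 97 ∣ N := step 61 97 (by norm_num) h61 (Ne.symm hp61) (by norm_num) (by norm_num)
      (by decide +kernel)
    -- `p` may still be one of these six; removing it leaves at least five.
    refine ⟨({13, 757, 61, 1609669, 14713, 97} : Finset ℕ).erase p, fun q hq => ?_,
      (show 5 = ({13, 757, 61, 1609669, 14713, 97} : Finset ℕ).card - 1 by decide) ▸
        Finset.pred_card_le_card_erase⟩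
    simp only [Finset.mem_erase, Finset.mem_insert, Finset.mem_singleton] at hq
    obtain ⟨hqp, rfl | rfl | rfl | rfl | rfl | rfl⟩ := hq <;>
      exact ⟨by norm_num, by assumption, hqp, by decide⟩
  exact absurd (hT5.trans ((E.card_le_of_forall_mem hT).trans hcard)) (by norm_num)

/-! ### Main result -/

theorem five_mul_lt_pow_of_seven_le (hl : 7 ≤ l) (ha : a ≠ 0) : 5 * a < l ^ a := by
  obtain ⟨b, rfl⟩ := Nat.exists_eq_succ_of_ne_zero ha
  refine lt_of_lt_of_le ?_ (Nat.pow_le_pow_left hl _)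
  clear ha
  induction b with
  | zero => norm_num
  | succ b ih => rw [pow_succ]; omega

theorem five_mul_lt_five_pow (ha : 2 ≤ a) : 5 * a < 5 ^ a := by
  induction a, ha using Nat.le_induction with
  | base => norm_num
  | succ b hb ih => rw [pow_succ]; omega

theorem five_mul_lt_three_pow (ha : 3 ≤ a) : 5 * a < 3 ^ a := by
  induction a, ha using Nat.le_induction with
  | base => norm_num
  | succ b hb ih => rw [pow_succ]; omega

theorem nonspecial_mul_le (E : IsEulerPerfect N p (l ^ a)) (hl : l.Prime) (hlN : l ∣ N)
    (hlp : l ≠ p) : 5 * a ≤ N.factorization l := by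
  rcases Nat.eq_zero_or_pos a with rfl | ha
  · omega
  have hdvd := E.dvd_exp l hl hlN hlp
  have hle := Nat.le_of_dvd (Nat.succ_pos _) hdvd
  have heven := E.even_exp l hl hlN hlp
  have h3 := E.three_le hl hlN
  rcases Nat.lt_or_ge l 7 with h7 | h7
  · interval_cases l
    · rcases Nat.lt_or_ge a 3 with h | h
      · interval_cases a
        · have := (show IsEulerPerfect N p 3 by simpa using E).factorization_three_ne_two hlp
          rw [Nat.even_iff] at heven
          omega
        · have := (show IsEulerPerfect N p 9 by simpa using E).factorization_three_ne_eight hlp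
          rw [Nat.even_iff] at heven
          omega
      · have := five_mul_lt_three_pow h
        omega
    · exact absurd hl (by norm_num)
    · rcases Nat.lt_or_ge a 2 with h | h
      · interval_cases a
        have := (show IsEulerPerfect N p 5 by simpa using E).factorization_five_ne_four hlp
        omega
      · have := five_mul_lt_five_pow h
        omega
    · exact absurd hl (by norm_num)
  · have := five_mul_lt_pow_of_seven_le h7 ha.ne'
    omega

theorem mono (E : IsEulerPerfect N p k) {d : ℕ} (hd : d ∣ k) : IsEulerPerfect N p d :=
  { E with dvd_exp := fun q h1 h2 h3 => hd.trans (E.dvd_exp q h1 h2 h3) }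

theorem mul_le_factorization (E : IsEulerPerfect N p (l ^ a)) (hl : l.Prime) :
    5 * a ≤ N.factorization l := by
  rcases Nat.eq_zero_or_pos a with rfl | ha
  · omega
  by_cases hlp : l = p
  · subst hlp
    exact E.special_mul_le
  · exact E.nonspecial_mul_le hl ((E.mono (dvd_pow_self l ha.ne')).dvd_of_dvd_exp hl) hlp

theorem pow_five_dvd (E : IsEulerPerfect N p k) : k ^ 5 ∣ N := by
  have hk : k ≠ 0 := E.odd_modulus.pos.ne'
  rw [← Nat.factorization_le_iff_dvd (pow_ne_zero 5 hk) E.ne_zero]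
  intro l
  by_cases hl : l.Prime
  · simpa using (E.mono (Nat.ordProj_dvd k l)).mul_le_factorization hl
  · simp [hl]

end IsEulerPerfect

/-! ### Reading off exponents from the given factorization -/

theorem mainTheorem1 (r : ℕ) (hr : 1 ≤ r) (N p α : ℕ) (q β : Fin (r - 1) → ℕ)
    (hodd : Odd N) (hperf : N.Perfect)
    (hp : p.Prime) (hq : ∀ i, (q i).Prime)
    (hq_inj : Function.Injective q) (hpq : ∀ i, q i ≠ p)
    (hp4 : p ≡ 1 [MOD 4]) (hα4 : α ≡ 1 [MOD 4]) (hβ : ∀ i, 0 < β i)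
    (hN : N = p ^ α * ∏ i, q i ^ (2 * β i))
    (t : ℤ) (ht : ∀ i, t ∣ 2 * (β i : ℤ) + 1) :
    t ^ 5 ∣ (N : ℤ) := by
  have hprod : ∏ i, q i ^ (2 * β i) ≠ 0 :=
    Finset.prod_ne_zero_iff.mpr fun i _ => pow_ne_zero _ (hq i).ne_zero
  have hfac : ∀ x : ℕ, N.factorization x =
      (if p = x then α else 0) + ∑ i, if q i = x then 2 * β i else 0 := fun x => by
    rw [hN, Nat.factorization_mul (pow_ne_zero _ hp.ne_zero) hprod,
      Nat.factorization_prod fun i _ => pow_ne_zero _ (hq i).ne_zero]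
    simp only [Finsupp.add_apply, Finsupp.finsetSum_apply, (hq _).factorization_pow,
      hp.factorization_pow, Finsupp.single_apply]
  have hfp : N.factorization p = α := by simp [hfac, hpq]
  have hfq : ∀ i, N.factorization (q i) = 2 * β i := fun i => by
    simp [hfac, (hpq i).symm, hq_inj.eq_iff]
  have hmem : ∀ x : ℕ, x.Prime → x ∣ N → x ≠ p → ∃ i, q i = x := fun x hx hxN hxp => by
    rw [hN] at hxN
    rcases hx.dvd_mul.mp hxN with h | h
    · exact absurd ((Nat.prime_dvd_prime_iff_eq hx hp).mp (hx.dvd_of_dvd_pow h)) hxp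
    · obtain ⟨i, -, hi⟩ := (hx.prime.dvd_finsetProd_iff _).mp h
      exact ⟨i, ((Nat.prime_dvd_prime_iff_eq hx (hq i)).mp (hx.dvd_of_dvd_pow hi)).symm⟩
  have E : IsEulerPerfect N p t.natAbs :=
    { odd := hodd
      sigma_eq := by
        rw [ArithmeticFunction.sigma_one_apply]
        exact (Nat.perfect_iff_sum_divisors_eq_two_mul hodd.pos).mp hperf
      prime := hp
      special_mod := hp4
      special_exp_mod := by rw [hfp]; exact hα4
      even_exp := fun x h1 h2 h3 => by
        obtain ⟨i, rfl⟩ := hmem x h1 h2 h3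
        exact ⟨β i, by rw [hfq]; ring⟩
      dvd_exp := fun x h1 h2 h3 => by
        obtain ⟨i, rfl⟩ := hmem x h1 h2 h3
        rw [hfq]
        exact Int.natAbs_dvd_natAbs.mpr (ht i) }
  rw [← Int.natAbs_dvd, Int.natAbs_pow]
  exact_mod_cast E.pow_five_dvd
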